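/- There exist absolute constants $\alpha>1$ and $c_1>0$ with the following property. Let $n\ge 1$ and let $K\subset\mathbb R^n$ be a convex body (a compact convex set with non-empty interior) whose center of mass $\frac{1}{|K|}\int_K x\,dx$ is at the origin. Let $N=\lceil\alpha n\rceil$ and let $x_1,\ldots,x_N$ be independent random points uniformly distributed in $K$. Then, with probability greater than $1-e^{-n}$, $$K\subseteq c_1 n\,\mathrm{conv}(\{x_1,\ldots,x_N\}).$$ -/

import Mathlib

open MeasureTheory ProbabilityTheory
open scoped Pointwise

/-!
Write `μ` for the uniform probability measure on `K`. The proof rests on one fact about half-spaces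
and one combinatorial union bound.

*Half-spaces.* If `k ∈ K` and `f` is a linear functional, then `μ {f ≥ f k / (2n)} ≥ 1/12`
(`one_twelfth_le_cond_halfSpace`). Indeed contracting `K` towards `k` by the factor `1 - 1/(2n)`
maps `K ∩ {f ≥ 0}` into that half-space and loses at most half of the volume, and
`μ {f ≥ 0} ≥ 1/6` is a weak form of Grünbaum's inequality (`one_sixth_le_cond_halfSpace`). The
latter holds because `F t = μ {f ≥ t}` satisfies `F s * F t ≤ F ((s + t) / 2) ^ 2` by the midpoint
Brunn–Minkowski inequality (`EuclideanSpace.volume_mul_volume_le`, from a midpoint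
Prékopa–Leindler inequality): if `F 0` were small, `F` would decay geometrically on the positive
side at the scale on which it rises to `1/2` on the negative side, and the mean of `f` would be
negative.

*Union bound.* If `K` is not contained in `2n • conv {x₁, …, x_N}`, some `z = k / (2n)` with `k ∈ K`
is outside the convex hull, so some affine function is `≤ 0` at every `x i` and `> 0` at `z`. After
normalizing its coefficients to `[-1, 1]`, it is a feasible point of a linear program in `n + 1`
unknowns, and it can be replaced by a vertex of the feasible polytope (`exists_vertex`). A vertex is
determined by `n + 1` of the `N + 2(n + 1)` constraints, hence by at most `n + 1` of the points.
Its positivity set contains `{f ≥ f z}`, for `f` its linear part, so has measure at least `1/12`;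
the other points, which are independent of those determining the vertex, all miss that set. This
has probability at most `(11/12) ^ (N - n - 1)` for each choice of constraints
(`pi_measure_le_of_dependsOn`), and the number of choices, `(N + 2(n + 1)).choose (n + 1)`, is
outweighed as soon as `N ≥ 240 n` (`choose_mul_pow_lt_exp_neg`). The bounds on the coefficients make
the polytope compact, so no general position of the points is needed.
-/

open scoped ENNReal

/-! ### Midpoint Prékopa–Leindler and Brunn–Minkowski inequalities -/

/-- The half-size translates of `A` and `B` that bring `max A` and `min B` to the same point lie in
`C` and overlap only at that point. -/
theorem Real.volume_add_volume_le_of_isCompact {A B C : Set ℝ} (hA : IsCompact A)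
    (hB : IsCompact B) (hA' : A.Nonempty) (hB' : B.Nonempty)
    (h : ∀ a ∈ A, ∀ b ∈ B, (a + b) / 2 ∈ C) : volume A + volume B ≤ 2 * volume C := by
  obtain ⟨k, hk, hkmax⟩ := hA.exists_isGreatest hA'
  obtain ⟨l, hl, hlmin⟩ := hB.exists_isLeast hB'
  have key : ∀ (S : Set ℝ) (c : ℝ), volume ((fun x => (x + c) / 2) '' S) = volume S / 2 := by
    intro S c
    have h1 : (fun x : ℝ => (x + c) / 2) '' S = (c / 2) +ᵥ ((1 / 2 : ℝ) • S) := by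
      ext y
      simp only [Set.mem_image, Set.mem_vadd_set, Set.mem_smul_set, vadd_eq_add, smul_eq_mul]
      constructor
      · rintro ⟨x, hx, rfl⟩
        exact ⟨_, ⟨x, hx, rfl⟩, by ring⟩
      · rintro ⟨_, ⟨x, hx, rfl⟩, rfl⟩
        exact ⟨x, hx, by ring⟩
    rw [h1, measure_vadd, Measure.addHaar_smul]
    simp only [Module.finrank_self, pow_one]
    rw [abs_of_pos (by norm_num), ENNReal.ofReal_div_of_pos (by norm_num)]
    simp [div_eq_mul_inv, mul_comm]
  have cont : ∀ c : ℝ, Continuous fun x : ℝ => (x + c) / 2 := fun c => by fun_prop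
  set A' := (fun x => (x + l) / 2) '' A
  set B' := (fun x => (x + k) / 2) '' B
  have hB'm : MeasurableSet B' := (hB.image (cont k)).measurableSet
  have hinter : A' ∩ B' ⊆ {(k + l) / 2} := by
    rintro _ ⟨⟨a, ha, rfl⟩, ⟨b, hb, hab⟩⟩
    have h1 := hkmax ha
    have h2 := hlmin hb
    simp only at hab
    simp only [Set.mem_singleton_iff]
    linarith
  have hsub : A' ∪ B' ⊆ C := by
    rintro _ (⟨a, ha, rfl⟩ | ⟨b, hb, rfl⟩)
    · exact h a ha l hl
    · simpa only [add_comm] using h k hk b hb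
  have hun : volume (A' ∪ B') = volume A' + volume B' := by
    have := measure_union_add_inter A' hB'm (μ := volume)
    rwa [measure_mono_null hinter (by simp), add_zero] at this
  calc volume A + volume B = 2 * (volume A' + volume B') := by
        rw [key, key, mul_add, ENNReal.mul_div_cancel (by simp) (by simp),
          ENNReal.mul_div_cancel (by simp) (by simp)]
    _ ≤ 2 * volume C := by rw [← hun]; gcongr

/-- The one-dimensional Brunn–Minkowski inequality for midpoints. -/
theorem Real.volume_add_volume_le {A B C : Set ℝ} (hA : MeasurableSet A)
    (hB : MeasurableSet B) (hA' : A.Nonempty) (hB' : B.Nonempty)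
    (h : ∀ a ∈ A, ∀ b ∈ B, (a + b) / 2 ∈ C) : volume A + volume B ≤ 2 * volume C := by
  obtain ⟨a, ha⟩ := hA'
  obtain ⟨b, hb⟩ := hB'
  rw [hA.measure_eq_iSup_isCompact, hB.measure_eq_iSup_isCompact]
  simp only [iSup_and']
  refine ENNReal.biSup_add_biSup_le' (p := fun K => K ⊆ A ∧ IsCompact K)
    (q := fun K => K ⊆ B ∧ IsCompact K) ⟨∅, by simp⟩ ⟨∅, by simp⟩ ?_
  rintro K ⟨hKA, hK⟩ K' ⟨hKB, hK'⟩
  calc volume K + volume K' ≤ volume (insert a K) + volume (insert b K') := by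
        gcongr <;> exact Set.subset_insert _ _
    _ ≤ 2 * volume C := by
        refine volume_add_volume_le_of_isCompact (hK.insert a) (hK'.insert b)
          ⟨a, by simp⟩ ⟨b, by simp⟩ fun x hx y hy => h x ?_ y ?_
        · exact Set.insert_subset ha hKA hx
        · exact Set.insert_subset hb hKB hy

/-- For functions with supremum `1`, the superlevel sets of `f` and `g` are nonempty at the same
levels, so the layer-cake formula integrates the one-dimensional Brunn–Minkowski inequality to an
arithmetic-mean form of the Prékopa–Leindler inequality. -/
theorem lintegral_add_lintegral_le_of_sup_eq_one {f g h : ℝ → ℝ} (hf : Measurable f)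
    (hg : Measurable g) (hh : Measurable h) (hf0 : 0 ≤ f) (hg0 : 0 ≤ g) (hh0 : 0 ≤ h)
    (hf1 : IsLUB (Set.range f) 1) (hg1 : IsLUB (Set.range g) 1)
    (hfgh : ∀ x y, f x * g y ≤ h ((x + y) / 2) ^ 2) :
    (∫⁻ x, ENNReal.ofReal (f x)) + ∫⁻ x, ENNReal.ofReal (g x)
      ≤ 2 * ∫⁻ x, ENNReal.ofReal (h x) := by
  have anti : ∀ u : ℝ → ℝ, Antitone fun t => volume {a | t < u a} := fun u s t hst =>
    measure_mono fun a ha => lt_of_le_of_lt hst ha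
  rw [lintegral_eq_lintegral_meas_lt _ (.of_forall hf0) hf.aemeasurable,
    lintegral_eq_lintegral_meas_lt _ (.of_forall hg0) hg.aemeasurable,
    lintegral_eq_lintegral_meas_lt _ (.of_forall hh0) hh.aemeasurable,
    ← lintegral_add_left (anti f).measurable, ← lintegral_const_mul _ (anti h).measurable]
  refine setLIntegral_mono (by exact (anti h).measurable.const_mul 2) fun t (ht : 0 < t) => ?_
  rcases lt_or_ge t 1 with h1 | h1
  · obtain ⟨_, ⟨x, rfl⟩, hx⟩ := (lt_isLUB_iff hf1).1 h1
    obtain ⟨_, ⟨y, rfl⟩, hy⟩ := (lt_isLUB_iff hg1).1 h1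
    refine Real.volume_add_volume_le (measurableSet_lt measurable_const hf)
      (measurableSet_lt measurable_const hg) ⟨x, hx⟩ ⟨y, hy⟩ fun a ha b hb => ?_
    refine lt_of_pow_lt_pow_left₀ 2 (hh0 _) (lt_of_lt_of_le ?_ (hfgh a b))
    rw [pow_two]
    exact mul_lt_mul'' ha hb ht.le ht.le
  · have e : ∀ u : ℝ → ℝ, IsLUB (Set.range u) 1 → {a | t < u a} = ∅ := fun u hu => by
      ext a
      simpa using (hu.1 ⟨a, rfl⟩).trans h1
    simp [e f hf1, e g hg1]

theorem ENNReal.four_mul_le_add_sq (a b : ℝ≥0∞) : 4 * (a * b) ≤ (a + b) ^ 2 := by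
  wlog hab : a ≤ b generalizing a b
  · rw [mul_comm a, add_comm a]; exact this b a (le_of_not_ge hab)
  obtain ⟨c, rfl⟩ := exists_add_of_le hab
  calc 4 * (a * (a + c)) ≤ 4 * (a * (a + c)) + c ^ 2 := le_self_add
    _ = (a + (a + c)) ^ 2 := by ring

theorem lintegral_mul_lintegral_le_of_bounded {f g h : ℝ → ℝ≥0∞} (hf : Measurable f)
    (hg : Measurable g) (hh : Measurable h) {M : ℝ≥0∞} (hM : M ≠ ∞)
    (hfM : ∀ x, f x ≤ M) (hgM : ∀ x, g x ≤ M)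
    (hfgh : ∀ x y, f x * g y ≤ h ((x + y) / 2) ^ 2) :
    (∫⁻ x, f x) * (∫⁻ x, g x) ≤ (∫⁻ x, h x) ^ 2 := by
  set F := ⨆ x, f x with hF
  set G := ⨆ x, g x with hG
  have hFt : F ≠ ∞ := ne_top_of_le_ne_top hM (iSup_le hfM)
  have hGt : G ≠ ∞ := ne_top_of_le_ne_top hM (iSup_le hgM)
  rcases eq_or_ne F 0 with hF0 | hF0
  · have : ∀ x, f x = 0 := fun x => le_antisymm (hF0 ▸ le_iSup f x) (by simp)
    simp [this]
  rcases eq_or_ne G 0 with hG0 | hG0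
  · have : ∀ x, g x = 0 := fun x => le_antisymm (hG0 ▸ le_iSup g x) (by simp)
    simp [this]
  have hFr : 0 < F.toReal := ENNReal.toReal_pos hF0 hFt
  have hGr : 0 < G.toReal := ENNReal.toReal_pos hG0 hGt
  -- truncating `h` at `M` keeps the hypothesis and makes all three functions finite
  set k : ℝ → ℝ≥0∞ := fun x => min (h x) M
  have hkt : ∀ x, k x ≠ ∞ := fun x => ne_top_of_le_ne_top hM (min_le_right _ _)
  have hfgk : ∀ x y, f x * g y ≤ k ((x + y) / 2) ^ 2 := fun x y => by
    rcases min_choice (h ((x + y) / 2)) M with h1 | h1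
    · simpa only [k, h1] using hfgh x y
    · simp only [k, h1, pow_two]
      exact mul_le_mul' (hfM x) (hgM y)
  have hft : ∀ x, f x ≠ ∞ := fun x => ne_top_of_le_ne_top hM (hfM x)
  have hgt : ∀ x, g x ≠ ∞ := fun x => ne_top_of_le_ne_top hM (hgM x)
  have lub : ∀ (u : ℝ → ℝ≥0∞), (⨆ x, u x) ≠ ∞ → (⨆ x, u x) ≠ 0 → (∀ x, u x ≠ ∞) →
      IsLUB (Set.range fun x => (u x).toReal / (⨆ x, u x).toReal) 1 := by
    intro u hu hu0 hux
    have hpos := ENNReal.toReal_pos hu0 hu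
    constructor
    · rintro _ ⟨x, rfl⟩
      exact (div_le_one hpos).2 (ENNReal.toReal_mono hu (le_iSup u x))
    · intro b hb
      have hb' : ∀ x, (u x).toReal ≤ b * (⨆ x, u x).toReal := fun x =>
        (div_le_iff₀ hpos).1 (hb ⟨x, rfl⟩)
      have : (⨆ x, u x) ≤ ENNReal.ofReal (b * (⨆ x, u x).toReal) :=
        iSup_le fun x => (ENNReal.le_ofReal_iff_toReal_le (hux x)
          (le_trans ENNReal.toReal_nonneg (hb' x))).2 (hb' x)
      have h2 := (ENNReal.le_ofReal_iff_toReal_le hu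
        (le_trans ENNReal.toReal_nonneg (hb' 0))).1 this
      nlinarith
  have scale : ∀ (u : ℝ → ℝ≥0∞) (c : ℝ), 0 < c → (∀ x, u x ≠ ∞) → Measurable u →
      ∫⁻ x, ENNReal.ofReal ((u x).toReal / c) = (∫⁻ x, u x) / ENNReal.ofReal c := by
    intro u c hc hu hum
    rw [div_eq_mul_inv, ← lintegral_mul_const _ hum]
    congr 1 with x
    rw [ENNReal.ofReal_div_of_pos hc, ENNReal.ofReal_toReal (hu x), div_eq_mul_inv]
  set s : ℝ := √(F.toReal * G.toReal)
  have hs : 0 < s := Real.sqrt_pos.2 (mul_pos hFr hGr)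
  have hss : ENNReal.ofReal s ^ 2 = F * G := by
    rw [← ENNReal.ofReal_pow hs.le, Real.sq_sqrt (mul_pos hFr hGr).le,
      ENNReal.ofReal_mul hFr.le, ENNReal.ofReal_toReal hFt, ENNReal.ofReal_toReal hGt]
  have hkm : Measurable k := hh.min measurable_const
  have key := lintegral_add_lintegral_le_of_sup_eq_one
    (f := fun x => (f x).toReal / F.toReal) (g := fun x => (g x).toReal / G.toReal)
    (h := fun x => (k x).toReal / s) (hf.ennreal_toReal.div_const _)
    (hg.ennreal_toReal.div_const _) (hkm.ennreal_toReal.div_const _)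
    (fun x => by simp only [Pi.zero_apply]; positivity)
    (fun x => by simp only [Pi.zero_apply]; positivity)
    (fun x => by simp only [Pi.zero_apply]; positivity)
    (lub f hFt hF0 hft) (lub g hGt hG0 hgt) (fun x y => by
      rw [div_mul_div_comm, div_pow, Real.sq_sqrt (mul_pos hFr hGr).le]
      gcongr
      rw [← ENNReal.toReal_mul, ← ENNReal.toReal_pow]
      exact ENNReal.toReal_mono (ENNReal.pow_ne_top (hkt _)) (hfgk x y))
  rw [scale f _ hFr hft hf, scale g _ hGr hgt hg, scale k _ hs hkt hkm,
    ENNReal.ofReal_toReal hFt, ENNReal.ofReal_toReal hGt] at key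
  have h4 : 4 * ((∫⁻ x, f x) / F * ((∫⁻ x, g x) / G)) ≤ 4 * ((∫⁻ x, k x) ^ 2 / (F * G)) := by
    refine (ENNReal.four_mul_le_add_sq _ _).trans ((pow_le_pow_left' key 2).trans_eq ?_)
    rw [← hss, mul_pow, div_eq_mul_inv, mul_pow, ← ENNReal.inv_pow, div_eq_mul_inv]
    norm_num
  rw [ENNReal.mul_le_mul_iff_right (by simp) (by simp),
    show ∀ a b : ℝ≥0∞, a / F * (b / G) = a * b / (F * G) from fun a b => by
      rw [div_eq_mul_inv, div_eq_mul_inv, div_eq_mul_inv, ENNReal.mul_inv (.inl hF0) (.inl hFt)]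
      ring,
    div_eq_mul_inv, div_eq_mul_inv, ENNReal.mul_le_mul_iff_left
      (ENNReal.inv_ne_zero.2 (ENNReal.mul_ne_top hFt hGt))
      (ENNReal.inv_ne_top.2 (mul_ne_zero hF0 hG0))] at h4
  refine h4.trans (pow_le_pow_left' (lintegral_mono fun x => min_le_left _ _) 2)

/-- The one-dimensional Prékopa–Leindler inequality for midpoints. -/
theorem lintegral_mul_lintegral_le_real {f g h : ℝ → ℝ≥0∞} (hf : Measurable f)
    (hg : Measurable g) (hh : Measurable h)
    (hfgh : ∀ x y, f x * g y ≤ h ((x + y) / 2) ^ 2) :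
    (∫⁻ x, f x) * (∫⁻ x, g x) ≤ (∫⁻ x, h x) ^ 2 := by
  have trunc : ∀ u : ℝ → ℝ≥0∞, Measurable u →
      ∫⁻ x, u x = ⨆ k : ℕ, ∫⁻ x, min (u x) k := by
    intro u hu
    rw [← lintegral_iSup (fun k => hu.min measurable_const)
      (fun i j hij x => min_le_min le_rfl (by exact_mod_cast hij))]
    congr 1 with x
    rw [← inf_iSup_eq, ENNReal.iSup_natCast, inf_top_eq]
  rw [trunc f hf, trunc g hg, ENNReal.iSup_mul]
  refine iSup_le fun i => ?_
  rw [ENNReal.mul_iSup]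
  refine iSup_le fun j => ?_
  refine lintegral_mul_lintegral_le_of_bounded (M := max i j) (hf.min measurable_const)
    (hg.min measurable_const) hh (by simp) (fun x => (min_le_right _ _).trans (le_max_left _ _))
    (fun x => (min_le_right _ _).trans (le_max_right _ _)) fun x y => ?_
  exact (mul_le_mul' (min_le_left _ _) (min_le_left _ _)).trans (hfgh x y)

/-- The Prékopa–Leindler inequality for midpoints, by induction on the dimension: the integrals over
the sections orthogonal to the first axis satisfy the one-dimensional hypothesis. -/
theorem lintegral_mul_lintegral_le_pi : ∀ {n : ℕ} {f g h : (Fin n → ℝ) → ℝ≥0∞},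
    Measurable f → Measurable g → Measurable h →
    (∀ x y, f x * g y ≤ h ((2⁻¹ : ℝ) • (x + y)) ^ 2) →
    (∫⁻ x, f x) * (∫⁻ x, g x) ≤ (∫⁻ x, h x) ^ 2
  | 0, f, g, h, hf, hg, hh, hfgh => by
    have := hfgh default default
    rw [volume_pi, Measure.pi_of_empty _ default, lintegral_dirac, lintegral_dirac,
      lintegral_dirac]
    rwa [Subsingleton.elim ((2⁻¹ : ℝ) • ((default : Fin 0 → ℝ) + default)) default] at this
  | n + 1, f, g, h, hf, hg, hh, hfgh => by
    let e := (MeasurableEquiv.piFinSuccAbove (fun _ : Fin (n + 1) => ℝ) 0).symm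
    have fubini : ∀ u : (Fin (n + 1) → ℝ) → ℝ≥0∞, Measurable u →
        ∫⁻ x, u x = ∫⁻ t : ℝ, ∫⁻ y : Fin n → ℝ, u (e (t, y)) := by
      intro u hu
      rw [← (volume_preserving_piFinSuccAbove (fun _ : Fin (n + 1) => ℝ) 0).symm.lintegral_comp hu,
        Measure.volume_eq_prod]
      exact lintegral_prod _ (hu.comp e.measurable).aemeasurable
    have meas : ∀ u : (Fin (n + 1) → ℝ) → ℝ≥0∞, Measurable u →
        Measurable fun t : ℝ => ∫⁻ y : Fin n → ℝ, u (e (t, y)) := fun u hu =>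
      (hu.comp e.measurable).lintegral_prod_right'
    rw [fubini f hf, fubini g hg, fubini h hh]
    refine lintegral_mul_lintegral_le_real (meas f hf) (meas g hg) (meas h hh) fun s t => ?_
    have sec : ∀ u : (Fin (n + 1) → ℝ) → ℝ≥0∞, Measurable u → ∀ t : ℝ,
        Measurable fun y : Fin n → ℝ => u (e (t, y)) := fun u hu t =>
      hu.comp (e.measurable.comp measurable_prodMk_left)
    refine lintegral_mul_lintegral_le_pi (sec f hf s) (sec g hg t) (sec h hh _) fun x y => ?_
    convert hfgh (e (s, x)) (e (t, y)) using 3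
    ext i
    refine Fin.cases ?_ (fun i => ?_) i
    · simp [e, Fin.insertNthEquiv]; ring
    · simp [e, Fin.insertNthEquiv]; ring

theorem measure_mul_measure_le_pi {n : ℕ} {A B C : Set (Fin n → ℝ)} (hA : MeasurableSet A)
    (hB : MeasurableSet B) (hC : MeasurableSet C)
    (h : ∀ a ∈ A, ∀ b ∈ B, (2⁻¹ : ℝ) • (a + b) ∈ C) : volume A * volume B ≤ volume C ^ 2 := by
  rw [← lintegral_indicator_one hA, ← lintegral_indicator_one hB, ← lintegral_indicator_one hC]
  refine lintegral_mul_lintegral_le_pi (measurable_one.indicator hA) (measurable_one.indicator hB)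
    (measurable_one.indicator hC) fun x y => ?_
  by_cases hx : x ∈ A
  · by_cases hy : y ∈ B
    · simp [hx, hy, Set.indicator_of_mem (h x hx y hy), -smul_add]
    · simp [hy]
  · simp [hx]

/-- The multiplicative Brunn–Minkowski inequality for midpoints. -/
theorem EuclideanSpace.volume_mul_volume_le {n : ℕ} {A B C : Set (EuclideanSpace ℝ (Fin n))}
    (hA : MeasurableSet A) (hB : MeasurableSet B) (hC : MeasurableSet C)
    (h : ∀ a ∈ A, ∀ b ∈ B, (2⁻¹ : ℝ) • (a + b) ∈ C) : volume A * volume B ≤ volume C ^ 2 := by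
  have e := EuclideanSpace.volume_preserving_symm_measurableEquiv_toLp (Fin n)
  have e' := e.symm
  rw [← e'.measure_preimage hA.nullMeasurableSet, ← e'.measure_preimage hB.nullMeasurableSet,
    ← e'.measure_preimage hC.nullMeasurableSet]
  refine measure_mul_measure_le_pi (e'.measurable hA) (e'.measurable hB) (e'.measurable hC) ?_
  intro a ha b hb
  exact h _ ha _ hb

/-! ### Half-spaces through the center of mass -/

theorem min_le_mul_sum_indicator (m x : ℝ) (M : ℕ) :
    min x (M * m) ≤ m * ∑ k ∈ Finset.range M, (Set.Ici (k * m)).indicator (fun _ => (1 : ℝ)) x := by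
  induction M with
  | zero => simp
  | succ M ih =>
    rw [Finset.sum_range_succ, mul_add]
    by_cases h : (M : ℝ) * m ≤ x
    · rw [min_eq_right h] at ih
      rw [Set.indicator_of_mem (by exact h)]
      refine (min_le_right _ _).trans ?_
      push_cast
      linarith
    · rw [min_eq_left (not_le.1 h).le] at ih
      rw [Set.indicator_of_notMem (by exact h)]
      simpa using .inl ih

/-- A bounded centered random variable whose tail `F t = P(X ≥ t)` is midpoint log-concave is
nonnegative with probability at least `1/6`. Take a scale `m` with `F (-m) ≥ 1/2 ≥ F (-(m/2))`.
If `F 0 < 1/6`, log-concavity gives `F (k m) ≤ F 0 * 3⁻ᵏ`, so the positive part of `X` has mean at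
most `3/2 * m * F 0 < m / 4`, while the negative part has mean at least `m / 4`. -/
theorem le_measureReal_nonneg_of_tail_logConcave {Ω : Type*} [MeasurableSpace Ω] {μ : Measure Ω}
    [IsProbabilityMeasure μ] {X : Ω → ℝ} (hX : Measurable X) {R : ℝ} (hR : ∀ᵐ ω ∂μ, |X ω| ≤ R)
    (h0 : ∫ ω, X ω ∂μ = 0)
    (hF : ∀ s t, μ.real {ω | s ≤ X ω} * μ.real {ω | t ≤ X ω} ≤
      μ.real {ω | (s + t) / 2 ≤ X ω} ^ 2) :
    1 / 6 ≤ μ.real {ω | 0 ≤ X ω} := by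
  wlog hRpos : 0 < R generalizing R
  · exact this (R := max R 1) (hR.mono fun ω h => h.trans (le_max_left _ _)) (by positivity)
  set F : ℝ → ℝ := fun t => μ.real {ω | t ≤ X ω} with hFdef
  have hFmono : Antitone F := fun s t hst => measureReal_mono fun ω h => hst.trans h
  have hF0 : ∀ t, 0 ≤ F t := fun t => measureReal_nonneg
  have hms : ∀ t, MeasurableSet {ω | t ≤ X ω} := fun t => measurableSet_le measurable_const hX
  by_contra! hlt
  change F 0 < 1 / 6 at hlt
  have hFR : F (-R) = 1 := by
    have : {ω | -R ≤ X ω} =ᵐ[μ] Set.univ := by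
      filter_upwards [hR] with ω h
      exact eq_true (neg_le_of_abs_le h)
    simp only [hFdef, measureReal_congr this, probReal_univ]
  have hlim : Filter.Tendsto (fun j : ℕ => F (-(R / 2 ^ j))) Filter.atTop (nhds (F 0)) := by
    have hinter : {ω | 0 ≤ X ω} = ⋂ j : ℕ, {ω | -(R / 2 ^ j) ≤ X ω} := by
      ext ω
      simp only [Set.mem_ofPred_eq, Set.mem_iInter]
      constructor
      · intro h j
        have : 0 ≤ R / 2 ^ j := by positivity
        linarith
      · intro h
        have ht : Filter.Tendsto (fun j : ℕ => -(R / 2 ^ j)) Filter.atTop (nhds (-0)) :=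
          (tendsto_const_nhds.div_atTop
            (tendsto_pow_atTop_atTop_of_one_lt (by norm_num : (1 : ℝ) < 2))).neg
        rw [neg_zero] at ht
        exact le_of_tendsto' ht h
    have := tendsto_measure_iInter_atTop (μ := μ) (s := fun j : ℕ => {ω | -(R / 2 ^ j) ≤ X ω})
      (fun j => (hms _).nullMeasurableSet) (fun i j hij ω (h : -(R / 2 ^ j) ≤ X ω) => by
        refine le_trans (neg_le_neg ?_) h
        exact div_le_div_of_nonneg_left hRpos.le (by positivity)
          (pow_le_pow_right₀ (by norm_num) hij)) ⟨0, measure_ne_top _ _⟩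
    rw [← hinter] at this
    exact (ENNReal.tendsto_toReal (measure_ne_top _ _)).comp this
  -- `m = R / 2 ^ j`, for `j + 1` the first exponent at which the tail drops below `1/2`
  obtain ⟨m, hm, hm1, hm2⟩ : ∃ m, 0 < m ∧ 1 / 2 ≤ F (-m) ∧ F (-(m / 2)) ≤ 1 / 2 := by
    have hex : ∃ j : ℕ, F (-(R / 2 ^ j)) < 1 / 2 :=
      (hlim.eventually_lt_const (by linarith : F 0 < 1 / 2)).exists
    classical
    obtain ⟨j, hj⟩ : ∃ j, Nat.find hex = j + 1 := by
      refine Nat.exists_eq_succ_of_ne_zero fun h => ?_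
      have := Nat.find_spec hex
      rw [h, pow_zero, div_one, hFR] at this
      norm_num at this
    refine ⟨R / 2 ^ j, by positivity, not_lt.1 (Nat.find_min hex (by omega)), ?_⟩
    have := Nat.find_spec hex
    rw [hj, pow_succ, ← div_div] at this
    exact this.le
  have hstep : ∀ k : ℕ, F ((k + 1 : ℕ) * m) ≤ 2 * F 0 * F (k * m) := by
    intro k
    induction k with
    | zero =>
      have := hF (-m) m
      rw [neg_add_cancel, zero_div] at this
      change F (-m) * F m ≤ F 0 ^ 2 at this
      simp only [Nat.cast_zero, zero_mul, zero_add, Nat.cast_one, one_mul]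
      nlinarith [hF0 m]
    | succ k ih =>
      have h1 := hF (k * m) ((k + 1 + 1 : ℕ) * m)
      rw [show ((k : ℝ) * m + (k + 1 + 1 : ℕ) * m) / 2 = (k + 1 : ℕ) * m by push_cast; ring] at h1
      change F (k * m) * F ((k + 1 + 1 : ℕ) * m) ≤ F ((k + 1 : ℕ) * m) ^ 2 at h1
      rcases (hF0 (k * m)).eq_or_lt with h2 | h2
      · have h3 : F ((k + 1 + 1 : ℕ) * m) ≤ F (k * m) := hFmono (by push_cast; nlinarith)
        have := hF0 ((k + 1 : ℕ) * m)
        have := hF0 0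
        rw [← h2] at h3
        exact h3.trans (by positivity)
      · refine le_of_mul_le_mul_left (h1.trans ?_) h2
        nlinarith [hF0 ((k + 1 : ℕ) * m)]
  have hgeom : ∀ k : ℕ, F (k * m) ≤ F 0 * (1 / 3) ^ k := by
    intro k
    induction k with
    | zero => simp
    | succ k ih =>
      refine (hstep k).trans ?_
      rw [pow_succ]
      nlinarith [hF0 0, hF0 (k * m)]
  obtain ⟨M, hM⟩ := exists_nat_ge (R / m)
  rw [div_le_iff₀ hm] at hM
  set S : Set Ω := {ω | -(m / 2) ≤ X ω}
  -- round the positive part of `X` up to a multiple of `m`, and its negative part down to `0` or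
  -- `m / 2`
  have hpt : ∀ᵐ ω ∂μ, X ω ≤ m * (∑ k ∈ Finset.range M,
      {ω | k * m ≤ X ω}.indicator (fun _ => (1 : ℝ)) ω)
      - m / 2 * Sᶜ.indicator (fun _ => (1 : ℝ)) ω := by
    filter_upwards [hR] with ω hω
    have h1 := min_le_mul_sum_indicator m (X ω) M
    rw [min_eq_left ((le_abs_self _).trans (hω.trans hM))] at h1
    have h2 : 0 ≤ ∑ k ∈ Finset.range M, {ω | k * m ≤ X ω}.indicator (fun _ => (1 : ℝ)) ω :=
      Finset.sum_nonneg fun k _ => Set.indicator_nonneg (fun _ _ => zero_le_one) _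
    by_cases hS : ω ∈ S
    · rw [Set.indicator_of_notMem (by simpa using hS), mul_zero, sub_zero]
      exact h1
    · rw [Set.indicator_of_mem (by simpa using hS)]
      have : X ω < -(m / 2) := not_le.1 hS
      nlinarith
  have hind : ∀ T : Set Ω, MeasurableSet T → Integrable (T.indicator fun _ => (1 : ℝ)) μ :=
    fun T hT => (integrable_const _).indicator hT
  have hi1 : Integrable (fun ω => m * ∑ k ∈ Finset.range M,
      {ω | k * m ≤ X ω}.indicator (fun _ => (1 : ℝ)) ω) μ :=
    (integrable_finsetSum _ fun k _ => hind _ (hms _)).const_mul m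
  have hi2 : Integrable (fun ω => m / 2 * Sᶜ.indicator (fun _ => (1 : ℝ)) ω) μ :=
    (hind _ (hms _).compl).const_mul _
  have hint := integral_mono_ae (.of_bound hX.aestronglyMeasurable R hR) (hi1.sub hi2) hpt
  simp only [Pi.sub_apply] at hint
  rw [h0, integral_sub hi1 hi2, integral_const_mul, integral_const_mul,
    integral_finsetSum _ fun k _ => hind _ (hms _), integral_indicator_const _ (hms _).compl,
    probReal_compl_eq_one_sub (hms _)] at hint
  simp only [integral_indicator_const _ (hms _), smul_eq_mul, mul_one] at hint
  have hsum : ∑ k ∈ Finset.range M, F (k * m) ≤ F 0 * (3 / 2) := by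
    refine (Finset.sum_le_sum fun k _ => hgeom k).trans ?_
    rw [← Finset.mul_sum]
    refine mul_le_mul_of_nonneg_left ?_ (hF0 0)
    rw [geom_sum_eq (by norm_num)]
    have : (0 : ℝ) ≤ (1 / 3) ^ M := by positivity
    rw [div_le_iff_of_neg (by norm_num)]
    linarith
  change (0 : ℝ) ≤ m * ∑ k ∈ Finset.range M, F (k * m) - m / 2 * (1 - F (-(m / 2))) at hint
  nlinarith

section ConvexBody

variable {n : ℕ} {K : Set (EuclideanSpace ℝ (Fin n))}

theorem cond_volume_real_apply (hK : IsCompact K) (S : Set (EuclideanSpace ℝ (Fin n))) :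
    (volume[|K]).real S = volume.real (K ∩ S) / volume.real K := by
  rw [measureReal_def, cond_apply hK.measurableSet, ENNReal.toReal_mul, ENNReal.toReal_inv,
    div_eq_inv_mul]
  rfl

theorem cond_halfSpace_logConcave (hK : IsCompact K) (hKc : Convex ℝ K)
    (f : EuclideanSpace ℝ (Fin n) →L[ℝ] ℝ) (s t : ℝ) :
    (volume[|K]).real {x | s ≤ f x} * (volume[|K]).real {x | t ≤ f x} ≤
      (volume[|K]).real {x | (s + t) / 2 ≤ f x} ^ 2 := by
  have hm : ∀ r, MeasurableSet (K ∩ {x | r ≤ f x}) := fun r =>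
    hK.measurableSet.inter (measurableSet_le measurable_const f.continuous.measurable)
  have key : volume (K ∩ {x | s ≤ f x}) * volume (K ∩ {x | t ≤ f x}) ≤
      volume (K ∩ {x | (s + t) / 2 ≤ f x}) ^ 2 := by
    refine EuclideanSpace.volume_mul_volume_le (hm s) (hm t) (hm _) ?_
    rintro a ⟨ha, hsa⟩ b ⟨hb, htb⟩
    refine ⟨?_, ?_⟩
    · rw [smul_add]
      exact hKc ha hb (by norm_num) (by norm_num) (by norm_num)
    · simp only [Set.mem_ofPred_eq, map_smul, map_add, smul_eq_mul] at *
      linarith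
  have fin : ∀ r, volume (K ∩ {x | r ≤ f x}) ≠ ∞ := fun r =>
    ne_top_of_le_ne_top hK.measure_ne_top (measure_mono Set.inter_subset_left)
  simp only [cond_volume_real_apply hK, div_mul_div_comm, div_pow]
  rw [← pow_two]
  gcongr
  have := ENNReal.toReal_mono (ENNReal.pow_ne_top (fin _)) key
  rwa [ENNReal.toReal_mul, ENNReal.toReal_pow] at this

/-- A weak form of Grünbaum's inequality, whose optimal constant is `exp (-1)`. -/
theorem one_sixth_le_cond_halfSpace (hK : IsCompact K) (hKc : Convex ℝ K)
    (hv : volume K ≠ 0) (h0 : ⨍ x in K, x = 0) (f : EuclideanSpace ℝ (Fin n) →L[ℝ] ℝ) :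
    1 / 6 ≤ (volume[|K]).real {x | 0 ≤ f x} := by
  have := cond_isProbabilityMeasure_of_finite hv hK.measure_ne_top
  obtain ⟨R, hR⟩ := hK.exists_bound_of_continuousOn f.continuous.continuousOn
  have hae : ∀ᵐ x ∂(volume[|K]), x ∈ K := ae_cond_mem hK.measurableSet
  refine le_measureReal_nonneg_of_tail_logConcave f.continuous.measurable (R := R)
    (hae.mono fun x hx => hR x hx) ?_ (cond_halfSpace_logConcave hK hKc f)
  have hint : Integrable (fun x => x) (volume[|K]) := by
    obtain ⟨R', hR'⟩ := hK.exists_bound_of_continuousOn continuous_id.continuousOn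
    exact .of_bound aestronglyMeasurable_id R' (hae.mono hR')
  have hc := f.integral_comp_comm hint
  rw [hc]
  have : ∫ x, x ∂(volume[|K]) = 0 := by
    rw [← h0, average, Measure.restrict_apply_univ]
    rfl
  rw [this, map_zero]

/-- The contraction towards `k` with ratio `1 - 1 / (2 * n)` maps `K ∩ {0 ≤ f}` into the half-space
`{f k / (2 * n) ≤ f}` and multiplies volumes by at least `1/2`, by Bernoulli's inequality. -/
theorem one_twelfth_le_cond_halfSpace (hn : 1 ≤ n) (hK : IsCompact K) (hKc : Convex ℝ K)
    (hv : volume K ≠ 0) (h0 : ⨍ x in K, x = 0) (f : EuclideanSpace ℝ (Fin n) →L[ℝ] ℝ)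
    {k : EuclideanSpace ℝ (Fin n)} (hk : k ∈ K) :
    1 / 12 ≤ (volume[|K]).real {x | f k / (2 * n) ≤ f x} := by
  have hn' : (1 : ℝ) ≤ n := by exact_mod_cast hn
  set c : ℝ := 1 / (2 * n) with hc
  have hc0 : 0 < c := by positivity
  have hc1 : c ≤ 1 / 2 := by
    rw [hc]; gcongr; linarith
  have hpow : 1 / 2 ≤ (1 - c) ^ n := by
    have := one_add_mul_le_pow (a := -c) (by linarith) n
    rw [← sub_eq_add_neg] at this
    refine le_trans (le_of_eq ?_) this
    rw [hc]; field_simp; norm_num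
  have hsub : (c • k) +ᵥ ((1 - c) • (K ∩ {x | 0 ≤ f x})) ⊆ K ∩ {x | f k / (2 * n) ≤ f x} := by
    rintro _ ⟨_, ⟨x, ⟨hx, hfx⟩, rfl⟩, rfl⟩
    refine ⟨hKc hk hx hc0.le (by linarith) (by ring), ?_⟩
    simp only [Set.mem_ofPred_eq, vadd_eq_add, map_add, map_smul, smul_eq_mul] at *
    have : f k / (2 * n) = c * f k := by rw [hc]; ring
    rw [this]
    have : 0 ≤ (1 - c) * f x := mul_nonneg (by linarith) hfx
    linarith
  have hvol := measureReal_mono hsub (μ := volume)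
    (ne_top_of_le_ne_top hK.measure_ne_top (measure_mono Set.inter_subset_left))
  rw [measureReal_def, measure_vadd, Measure.addHaar_smul, finrank_euclideanSpace_fin,
    ENNReal.toReal_mul, ENNReal.toReal_ofReal (abs_nonneg _),
    abs_of_nonneg (pow_nonneg (by linarith) _)] at hvol
  have h6 := one_sixth_le_cond_halfSpace hK hKc hv h0 f
  rw [cond_volume_real_apply hK] at h6 ⊢
  have hKpos : 0 < volume.real K := ENNReal.toReal_pos hv hK.measure_ne_top
  rw [le_div_iff₀ hKpos] at h6 ⊢
  refine le_trans ?_ hvol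
  calc 1 / 12 * volume.real K = 1 / 2 * (1 / 6 * volume.real K) := by ring
    _ ≤ _ := mul_le_mul hpow h6 (by positivity) (pow_nonneg (by linarith) _)

end ConvexBody

/-! ### Vertices of the polytope of separating affine functions -/

open Matrix in
/-- A linear functional on a bounded polytope is maximized at a vertex, and the normals of the
constraints that are tight at a vertex span the space. -/
theorem exists_vertex {d : ℕ} {C : Type*} [Fintype C] (a : C → Fin d → ℝ) (b : C → ℝ)
    (hbdd : Bornology.IsBounded {φ | ∀ c, a c ⬝ᵥ φ ≤ b c}) (w φ₀ : Fin d → ℝ)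
    (hφ₀ : ∀ c, a c ⬝ᵥ φ₀ ≤ b c) :
    ∃ φ : Fin d → ℝ, (∀ c, a c ⬝ᵥ φ ≤ b c) ∧ w ⬝ᵥ φ₀ ≤ w ⬝ᵥ φ ∧
      Submodule.span ℝ (Set.range fun c : {c // a c ⬝ᵥ φ = b c} => a c) = ⊤ := by
  set Q : Set (Fin d → ℝ) := {φ | ∀ c, a c ⬝ᵥ φ ≤ b c} with hQ
  have hcont : ∀ v : Fin d → ℝ, Continuous fun φ : Fin d → ℝ => v ⬝ᵥ φ := fun v =>
    Continuous.dotProduct continuous_const continuous_id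
  have hQc : IsClosed Q := by
    rw [hQ, Set.ofPred_forall]
    exact isClosed_iInter fun c => isClosed_le (hcont _) continuous_const
  have hQk : IsCompact Q := Metric.isCompact_of_isClosed_isBounded hQc hbdd
  let l : StrongDual ℝ (Fin d → ℝ) := LinearMap.toContinuousLinearMap (dotProductEquiv ℝ (Fin d) w)
  have hl : ∀ φ, l φ = w ⬝ᵥ φ := fun φ => rfl
  have hF : IsExposed ℝ Q (l.toExposed Q) := ContinuousLinearMap.toExposed.isExposed
  obtain ⟨ψ, hψQ, hψ⟩ := hQk.exists_isMaxOn ⟨φ₀, hφ₀⟩ l.continuous.continuousOn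
  obtain ⟨φ, hφ⟩ := (hF.isCompact hQk).extremePoints_nonempty ⟨ψ, hψQ, hψ⟩
  have hφF : φ ∈ l.toExposed Q := hφ.1
  have hφQ : φ ∈ Q.extremePoints ℝ := hF.isExtreme.extremePoints_subset_extremePoints hφ
  refine ⟨φ, hφQ.1, hφF.2 φ₀ hφ₀, ?_⟩
  by_contra hspan
  obtain ⟨f, hf0, hf⟩ := Submodule.exists_le_ker_of_lt_top _ (lt_top_iff_ne_top.2 hspan)
  obtain ⟨u, rfl⟩ := (dotProductEquiv ℝ (Fin d)).surjective f
  have hu : u ≠ 0 := by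
    rintro rfl
    exact hf0 (map_zero _)
  have htight : ∀ c, a c ⬝ᵥ φ = b c → a c ⬝ᵥ u = 0 := fun c hc => by
    have := hf (Submodule.subset_span ⟨⟨c, hc⟩, rfl⟩)
    rw [dotProduct_comm]
    exact this
  -- moving a little in the directions `± u` stays in the polytope, contradicting extremality
  have hev : ∀ᶠ t : ℝ in nhds 0, ∀ c, a c ⬝ᵥ (φ + t • u) ≤ b c := by
    refine Filter.eventually_all.2 fun c => ?_
    rcases (hφQ.1 c).eq_or_lt with h | h
    · exact .of_forall fun t => by simp [dotProduct_add, htight c h, h]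
    · have : Filter.Tendsto (fun t : ℝ => a c ⬝ᵥ (φ + t • u)) (nhds 0) (nhds (a c ⬝ᵥ φ)) := by
        have : Continuous fun t : ℝ => a c ⬝ᵥ (φ + t • u) := (hcont _).comp (by fun_prop)
        simpa using this.tendsto 0
      exact (this.eventually_lt_const h).mono fun t ht => ht.le
  obtain ⟨δ, hδ, hball⟩ := Metric.eventually_nhds_iff.1 hev
  have h1 : φ + (δ / 2) • u ∈ Q := hball (by
    rw [Real.dist_eq, sub_zero, abs_of_pos (by positivity)]; linarith)
  have h2 : φ + (-(δ / 2)) • u ∈ Q := hball (by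
    rw [Real.dist_eq, sub_zero, abs_neg, abs_of_pos (by positivity)]; linarith)
  have hseg : φ ∈ openSegment ℝ (φ + (δ / 2) • u) (φ + (-(δ / 2)) • u) :=
    ⟨1 / 2, 1 / 2, by norm_num, by norm_num, by norm_num, by module⟩
  have := hφQ.2 h1 h2 hseg
  rw [add_eq_left, smul_eq_zero] at this
  rcases this with h | h
  · linarith
  · exact hu h

open Matrix in
/-- The solution of the linear system `a c ⬝ᵥ φ = b c`, `c ∈ S`, multiplied by `det G ^ 2`, where
`G = ∑ c ∈ S, a c (a c)ᵀ` is the matrix of the normal equations; the system is assumed consistent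
and `a c`, `c ∈ S`, to span. The factor makes the expression polynomial in `a` and `b`, and it is
harmless because only the signs of affine functions matter. -/
def gramSolution {d : ℕ} {C : Type*} (a : C → Fin d → ℝ) (b : C → ℝ) (S : Finset C) :
    Fin d → ℝ :=
  (∑ c ∈ S, vecMulVec (a c) (a c)).det •
    ((∑ c ∈ S, vecMulVec (a c) (a c)).adjugate *ᵥ ∑ c ∈ S, b c • a c)

open Matrix in
theorem exists_gramSolution_eq {d : ℕ} {C : Type*} (a : C → Fin d → ℝ) (b : C → ℝ)
    (S : Finset C) (φ : Fin d → ℝ) (hS : ∀ c ∈ S, a c ⬝ᵥ φ = b c)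
    (hspan : Submodule.span ℝ (a '' S) = ⊤) : ∃ r : ℝ, 0 < r ∧ gramSolution a b S = r • φ := by
  set G := ∑ c ∈ S, vecMulVec (a c) (a c) with hG
  have hGv : ∀ v, G *ᵥ v = ∑ c ∈ S, (a c ⬝ᵥ v) • a c := fun v => by
    rw [hG, sum_mulVec]
    refine Finset.sum_congr rfl fun c _ => ?_
    rw [vecMulVec_mulVec]
    simp
  have hdet : G.det ≠ 0 := by
    intro h0
    obtain ⟨v, hv0, hv⟩ := exists_mulVec_eq_zero_iff.2 h0
    have h1 : ∑ c ∈ S, (a c ⬝ᵥ v) ^ 2 = 0 := by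
      have := congrArg (fun u => u ⬝ᵥ v) (hGv v)
      simp only [hv, zero_dotProduct, sum_dotProduct, smul_dotProduct, smul_eq_mul] at this
      simpa [pow_two] using this.symm
    have h2 : ∀ c ∈ S, a c ⬝ᵥ v = 0 := fun c hc =>
      pow_eq_zero_iff two_ne_zero |>.1
        ((Finset.sum_eq_zero_iff_of_nonneg fun c _ => sq_nonneg _).1 h1 c hc)
    have h3 : Submodule.span ℝ (a '' S) ≤ LinearMap.ker (dotProductEquiv ℝ (Fin d) v) := by
      refine Submodule.span_le.2 ?_
      rintro _ ⟨c, hc, rfl⟩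
      have := h2 c hc
      rw [dotProduct_comm] at this
      exact this
    rw [hspan, top_le_iff, LinearMap.ker_eq_top] at h3
    exact hv0 ((LinearEquiv.map_eq_zero_iff _).1 h3)
  refine ⟨G.det ^ 2, by positivity, ?_⟩
  have hrhs : ∑ c ∈ S, b c • a c = G *ᵥ φ := by
    rw [hGv]
    exact Finset.sum_congr rfl fun c hc => by rw [hS c hc]
  rw [gramSolution, ← hG, hrhs, mulVec_mulVec, adjugate_mul, smul_mulVec, one_mulVec, smul_smul,
    pow_two]

theorem exists_finset_card_eq_finrank {d : ℕ} {C : Type*} [Fintype C] (a : C → Fin d → ℝ)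
    (p : C → Prop) (h : Submodule.span ℝ (Set.range fun c : {c // p c} => a c) = ⊤) :
    ∃ S : Finset C, S.card = d ∧ (∀ c ∈ S, p c) ∧ Submodule.span ℝ (a '' S) = ⊤ := by
  classical
  obtain ⟨κ, e, he, hspan, hli⟩ := exists_linearIndependent' ℝ fun c : {c // p c} => a c
  have : Finite κ := Finite.of_injective e he
  have := Fintype.ofFinite κ
  refine ⟨Finset.univ.map ⟨fun k => (e k : C), Subtype.val_injective.comp he⟩, ?_, ?_, ?_⟩
  · have h1 := finrank_span_eq_card hli
    rw [hspan, h, finrank_top, Module.finrank_fin_fun] at h1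
    rw [Finset.card_map, Finset.card_univ, h1]
  · simp only [Finset.mem_map]
    rintro _ ⟨k, -, rfl⟩
    exact (e k).2
  · rw [← h, ← hspan]
    congr 1
    ext y
    simp

section Separation

variable {n N : ℕ}

/-- The affine embedding `x ↦ (1, x)` of `ℝⁿ` in `ℝⁿ⁺¹`, which turns affine functions into linear
ones. -/
def homogenize (x : EuclideanSpace ℝ (Fin n)) : Fin (n + 1) → ℝ := Fin.cons 1 x.ofLp

/-- Normals of the inequalities, in the unknown `φ`, saying that the affine function with
coefficient vector `φ` is nonpositive at each point `x i` and has coefficients in `[-1, 1]`. -/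
def normals (x : Fin N → EuclideanSpace ℝ (Fin n)) :
    Fin N ⊕ (Fin (n + 1) ⊕ Fin (n + 1)) → Fin (n + 1) → ℝ :=
  Sum.elim (fun i => homogenize (x i))
    (Sum.elim (fun k => Pi.single k 1) (fun k => -Pi.single k 1))

/-- Right-hand sides of the inequalities whose normals are `normals x`. -/
def bounds (n N : ℕ) : Fin N ⊕ (Fin (n + 1) ⊕ Fin (n + 1)) → ℝ :=
  Sum.elim (fun _ => 0) (fun _ => 1)

open Matrix in
theorem exists_separating_affine {x : Fin N → EuclideanSpace ℝ (Fin n)}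
    {z : EuclideanSpace ℝ (Fin n)} (hz : z ∉ convexHull ℝ (Set.range x)) :
    ∃ φ : Fin (n + 1) → ℝ, (∀ i, homogenize (x i) ⬝ᵥ φ ≤ 0) ∧ 0 < homogenize z ⬝ᵥ φ := by
  obtain ⟨f, u, hf, hu⟩ := geometric_hahn_banach_closed_point (convex_convexHull ℝ _)
    ((Set.finite_range x).isClosed_convexHull ℝ) hz
  have key : ∀ y, homogenize y ⬝ᵥ (Fin.cons (-u) fun i => f (EuclideanSpace.single i 1)) =
      f y - u := by
    intro y
    have hy : f y = ∑ i, y i * f (EuclideanSpace.single i 1) := by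
      conv_lhs => rw [← (EuclideanSpace.basisFun (Fin n) ℝ).sum_repr y]
      simp [map_sum]
    rw [hy, dotProduct, Fin.sum_univ_succ]
    simp [homogenize]
    ring
  refine ⟨Fin.cons (-u) fun i => f (EuclideanSpace.single i 1), fun i => ?_, ?_⟩
  · rw [key]
    linarith [hf (x i) (subset_convexHull ℝ _ ⟨i, rfl⟩)]
  · rw [key]
    linarith

open Matrix in
/-- The coefficients of an affine function separating `z` from the points `x i` can be computed from
`n + 1` constraints, and so from at most `n + 1` of the points. -/
theorem exists_gramSolution_separating {x : Fin N → EuclideanSpace ℝ (Fin n)}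
    {z : EuclideanSpace ℝ (Fin n)} (hz : z ∉ convexHull ℝ (Set.range x)) :
    ∃ S : Finset (Fin N ⊕ (Fin (n + 1) ⊕ Fin (n + 1))), S.card = n + 1 ∧
      (∀ i, homogenize (x i) ⬝ᵥ gramSolution (normals x) (bounds n N) S ≤ 0) ∧
      0 < homogenize z ⬝ᵥ gramSolution (normals x) (bounds n N) S := by
  obtain ⟨φ₁, h1, h1z⟩ := exists_separating_affine hz
  set r := (‖φ₁‖ + 1)⁻¹ with hr
  have hrpos : 0 < r := by positivity
  have hcoord : ∀ k, |r * φ₁ k| ≤ 1 := fun k => by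
    rw [abs_mul, abs_of_pos hrpos, hr, inv_mul_le_iff₀ (by positivity), mul_one]
    have := norm_le_pi_norm φ₁ k
    rw [Real.norm_eq_abs] at this
    linarith
  obtain ⟨φ, hφ, hφz, hspan⟩ := exists_vertex (normals x) (bounds n N) (by
      refine (Metric.isBounded_closedBall (x := (0 : Fin (n + 1) → ℝ)) (r := 1)).subset ?_
      intro φ hφ
      rw [mem_closedBall_zero_iff, pi_norm_le_iff_of_nonneg zero_le_one]
      intro k
      have h1 := hφ (.inr (.inl k))
      have h2 := hφ (.inr (.inr k))
      simp only [normals, bounds, Sum.elim_inr, Sum.elim_inl, single_dotProduct, one_mul,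
        neg_dotProduct] at h1 h2
      exact abs_le.2 ⟨by linarith, h1⟩) (homogenize z) (r • φ₁) (by
      rintro (i | k | k)
      · simpa [normals, bounds] using mul_nonpos_of_nonneg_of_nonpos hrpos.le (h1 i)
      · simpa [normals, bounds] using (abs_le.1 (hcoord k)).2
      · simpa [normals, bounds] using neg_le.1 (neg_le_of_abs_le (hcoord k)))
  obtain ⟨S, hcard, hS, hSspan⟩ := exists_finset_card_eq_finrank _ _ hspan
  obtain ⟨t, ht, hsol⟩ := exists_gramSolution_eq _ _ S φ hS hSspan
  refine ⟨S, hcard, fun i => ?_, ?_⟩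
  · rw [hsol, dotProduct_smul]
    exact mul_nonpos_of_nonneg_of_nonpos ht.le (hφ (.inl i))
  · rw [hsol, dotProduct_smul]
    refine mul_pos ht (lt_of_lt_of_le ?_ hφz)
    rw [dotProduct_smul]
    exact mul_pos hrpos h1z

theorem continuous_homogenize : Continuous (homogenize (n := n)) := by
  unfold homogenize
  fun_prop

open Matrix in
theorem continuous_gramSolution (S : Finset (Fin N ⊕ (Fin (n + 1) ⊕ Fin (n + 1)))) :
    Continuous fun x : Fin N → EuclideanSpace ℝ (Fin n) =>
      gramSolution (normals x) (bounds n N) S := by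
  have hn : ∀ c, Continuous fun x : Fin N → EuclideanSpace ℝ (Fin n) => normals x c := by
    rintro (i | k | k)
    · exact continuous_homogenize.comp (continuous_apply i)
    · exact continuous_const
    · exact continuous_const
  have hG : Continuous fun x : Fin N → EuclideanSpace ℝ (Fin n) =>
      ∑ c ∈ S, vecMulVec (normals x c) (normals x c) :=
    continuous_finsetSum _ fun c _ => (hn c).matrix_vecMulVec (hn c)
  exact hG.matrix_det.smul (hG.matrix_adjugate.matrix_mulVec
    (continuous_finsetSum _ fun c _ => Continuous.fun_const_smul (hn c) (bounds n N c)))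

theorem gramSolution_congr {x x' : Fin N → EuclideanSpace ℝ (Fin n)}
    {S : Finset (Fin N ⊕ (Fin (n + 1) ⊕ Fin (n + 1)))} (h : ∀ i, .inl i ∈ S → x i = x' i) :
    gramSolution (normals x) (bounds n N) S = gramSolution (normals x') (bounds n N) S := by
  have hn : ∀ c ∈ S, normals x c = normals x' c := by
    rintro (i | k | k) hc
    · simp [normals, h i hc]
    · rfl
    · rfl
  have h1 : ∑ c ∈ S, Matrix.vecMulVec (normals x c) (normals x c) =
      ∑ c ∈ S, Matrix.vecMulVec (normals x' c) (normals x' c) :=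
    Finset.sum_congr rfl fun c hc => by rw [hn c hc]
  have h2 : ∑ c ∈ S, bounds n N c • normals x c = ∑ c ∈ S, bounds n N c • normals x' c :=
    Finset.sum_congr rfl fun c hc => by rw [hn c hc]
  rw [gramSolution, gramSolution, h1, h2]

end Separation

/-! ### The union bound -/

/-- Suppose the set `{0 < g x}` depends only on the coordinates `x i`, `i ∈ T`. The probability that
it has measure at least `c` and is missed by all the other coordinates is at most
`(1 - c) ^ #Tᶜ`, by Fubini's theorem. -/
theorem pi_measure_le_of_dependsOn {ι E : Type*} [Fintype ι] [MeasurableSpace E]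
    (μ : Measure E) [IsProbabilityMeasure μ] (T : Finset ι) {g : (ι → E) → E → ℝ}
    (hg : Measurable (Function.uncurry g))
    (hT : ∀ x x' : ι → E, (∀ i ∈ T, x i = x' i) → g x = g x') (c : ℝ) :
    Measure.pi (fun _ : ι => μ)
        {x | c ≤ μ.real {y | 0 < g x y} ∧ ∀ i, i ∉ T → g x (x i) ≤ 0} ≤
      ENNReal.ofReal (1 - c) ^ (Fintype.card ι - T.card) := by
  classical
  have : Nonempty E := μ.nonempty_of_neZero
  let y₀ : E := Classical.arbitrary E
  let e := MeasurableEquiv.piEquivPiSubtypeProd (fun _ : ι => E) (· ∈ T)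
  -- `g` as a function of the coordinates in `T` only; the value `y₀` of the others is irrelevant
  let g' : ({i // i ∈ T} → E) → E → ℝ := fun u => g (e.symm (u, fun _ => y₀))
  have hg' : Measurable (Function.uncurry g') :=
    hg.comp ((e.symm.measurable.comp (measurable_fst.prodMk measurable_const)).prodMk
      measurable_snd)
  have hge : ∀ x, g' (e x).1 = g x := fun x => hT _ _ fun i hi => by
    simp [e, MeasurableEquiv.piEquivPiSubtypeProd, Equiv.piEquivPiSubtypeProd, hi]
  set A : Set (({i // i ∈ T} → E) × ({i // i ∉ T} → E)) :=
    {p | c ≤ μ.real {y | 0 < g' p.1 y} ∧ ∀ i, g' p.1 (p.2 i) ≤ 0} with hA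
  have hpre : {x | c ≤ μ.real {y | 0 < g x y} ∧ ∀ i, i ∉ T → g x (x i) ≤ 0} = e ⁻¹' A := by
    ext x
    simp only [hA, Set.mem_preimage, Set.mem_ofPred_eq, hge, Subtype.forall]
    rfl
  have hAm : MeasurableSet A := by
    have h1 : Measurable fun u => μ.real {y | 0 < g' u y} :=
      (measurable_measure_prodMk_left (ν := μ)
        (measurableSet_lt measurable_const hg')).ennreal_toReal
    have h2 : MeasurableSet {p : ({i // i ∈ T} → E) × ({i // i ∉ T} → E) |
        ∀ i, g' p.1 (p.2 i) ≤ 0} := by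
      rw [Set.ofPred_forall]
      refine MeasurableSet.iInter fun i => measurableSet_le ?_ measurable_const
      exact hg'.comp (measurable_fst.prodMk ((measurable_pi_apply i).comp measurable_snd))
    exact (measurableSet_le measurable_const (h1.comp measurable_fst)).inter h2
  rw [hpre, (measurePreserving_piEquivPiSubtypeProd (fun _ : ι => μ) (· ∈ T)).measure_preimage
    hAm.nullMeasurableSet, Measure.prod_apply hAm]
  have hslice : ∀ u, Measure.pi (fun _ : {i // i ∉ T} => μ) (Prod.mk u ⁻¹' A) ≤
      ENNReal.ofReal (1 - c) ^ (Fintype.card ι - T.card) := by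
    intro u
    by_cases hu : c ≤ μ.real {y | 0 < g' u y}
    · have hm : MeasurableSet {y | 0 < g' u y} :=
        measurableSet_lt measurable_const (hg'.comp measurable_prodMk_left)
      have hsub : Prod.mk u ⁻¹' A ⊆ Set.univ.pi fun _ => {y | 0 < g' u y}ᶜ :=
        fun v hv i _ => not_lt.2 (hv.2 i)
      refine (measure_mono hsub).trans ?_
      rw [Measure.pi_pi, Finset.prod_const, Finset.card_univ, Fintype.card_subtype_compl,
        Fintype.card_coe]
      refine pow_le_pow_left' ?_ _
      rw [← ofReal_measureReal, probReal_compl_eq_one_sub hm]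
      exact ENNReal.ofReal_le_ofReal (by linarith)
    · have : Prod.mk u ⁻¹' A = ∅ := by
        ext v
        simpa [hA] using fun h => absurd h hu
      simp [this]
  refine (lintegral_mono hslice).trans ?_
  simp

theorem choose_mul_pow_lt_exp_neg {n N : ℕ} (hn : 1 ≤ n) (hN : 240 * n ≤ N) :
    ((N + 2 * (n + 1)).choose (n + 1) : ℝ) * (11 / 12) ^ (N - (n + 1)) < Real.exp (-n) := by
  set d := n + 1 with hd
  set m := N + 2 * d with hm
  -- a single term of the binomial expansion of `(1 / 24 + 1) ^ m`
  have h1 : (m.choose d : ℝ) * (1 / 24) ^ d ≤ Real.exp (m / 24) := by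
    have hle : d ≤ m := by omega
    calc (m.choose d : ℝ) * (1 / 24) ^ d
        ≤ ∑ k ∈ Finset.range (m + 1), (1 / 24 : ℝ) ^ k * 1 ^ (m - k) * m.choose k := by
          refine le_trans (le_of_eq ?_) (Finset.single_le_sum (fun k _ => by positivity)
            (Finset.mem_range.2 (Nat.lt_succ_of_le hle)))
          rw [one_pow, mul_one, mul_comm]
      _ = (1 / 24 + 1) ^ m := (add_pow _ _ _).symm
      _ ≤ Real.exp (1 / 24) ^ m := pow_le_pow_left₀ (by norm_num) (Real.add_one_le_exp _) _
      _ = Real.exp (m / 24) := by rw [← Real.exp_nat_mul]; ring_nf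
  have h24 : (24 : ℝ) ^ d ≤ Real.exp (4 * d) := by
    have : (24 : ℝ) ≤ Real.exp 4 := by
      have h := Real.exp_one_gt_d9
      rw [show (4 : ℝ) = (4 : ℕ) * 1 by norm_num, Real.exp_nat_mul]
      exact le_trans (by norm_num) (pow_le_pow_left₀ (by norm_num) h.le 4)
    rw [mul_comm, Real.exp_nat_mul]
    exact pow_le_pow_left₀ (by norm_num) this _
  have h2 : (m.choose d : ℝ) ≤ Real.exp (4 * d) * Real.exp (m / 24) := by
    calc (m.choose d : ℝ) = 24 ^ d * (m.choose d * (1 / 24) ^ d) := by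
          rw [mul_left_comm, ← mul_pow]; norm_num
      _ ≤ _ := mul_le_mul h24 h1 (by positivity) (Real.exp_pos _).le
  have h3 : (11 / 12 : ℝ) ^ (N - d) ≤ Real.exp (-((N : ℝ) - d) / 12) := by
    have : (11 / 12 : ℝ) ≤ Real.exp (-1 / 12) := by
      have := Real.add_one_le_exp (-1 / 12 : ℝ)
      linarith
    refine (pow_le_pow_left₀ (by norm_num) this _).trans_eq ?_
    rw [← Real.exp_nat_mul, Nat.cast_sub (by omega)]
    ring_nf
  calc _ ≤ Real.exp (4 * d) * Real.exp (m / 24) * Real.exp (-((N : ℝ) - d) / 12) :=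
        mul_le_mul h2 h3 (by positivity) (by positivity)
    _ = Real.exp (4 * d + m / 24 + -((N : ℝ) - d) / 12) := by rw [Real.exp_add, Real.exp_add]
    _ < Real.exp (-n) := by
        refine Real.exp_lt_exp.2 ?_
        have hN' : (240 : ℝ) * n ≤ N := by exact_mod_cast hN
        have hn' : (1 : ℝ) ≤ n := by exact_mod_cast hn
        rw [hm, hd]
        push_cast
        linarith

open Matrix in
/-- The set `B` is the finite union, over all choices of `n + 1` constraints, of the events that the
half-space computed from them has measure at least `1/12` and contains none of the points that do
not enter these constraints. -/
theorem pi_measure_not_subset_lt {n N : ℕ} (hn : 1 ≤ n) (hN : 240 * n ≤ N)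
    {K : Set (EuclideanSpace ℝ (Fin n))} (hK : IsCompact K) (hKc : Convex ℝ K)
    (hv : volume K ≠ 0) (h0 : ⨍ x in K, x = 0) :
    ∃ B : Set (Fin N → EuclideanSpace ℝ (Fin n)),
      {x | ¬ K ⊆ (2 * (n : ℝ)) • convexHull ℝ (Set.range x)} ⊆ B ∧
      Measure.pi (fun _ : Fin N => volume[|K]) B < ENNReal.ofReal (Real.exp (-n)) := by
  classical
  have := cond_isProbabilityMeasure_of_finite hv hK.measure_ne_top
  let sol (S : Finset (Fin N ⊕ (Fin (n + 1) ⊕ Fin (n + 1)))) (x : Fin N → EuclideanSpace ℝ (Fin n))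
      (y : EuclideanSpace ℝ (Fin n)) : ℝ := homogenize y ⬝ᵥ gramSolution (normals x) (bounds n N) S
  let T (S : Finset (Fin N ⊕ (Fin (n + 1) ⊕ Fin (n + 1)))) : Finset (Fin N) := S.toLeft
  let A (S : Finset (Fin N ⊕ (Fin (n + 1) ⊕ Fin (n + 1)))) :
      Set (Fin N → EuclideanSpace ℝ (Fin n)) :=
    {x | 1 / 12 ≤ (volume[|K]).real {y | 0 < sol S x y} ∧ ∀ i, i ∉ T S → sol S x (x i) ≤ 0}
  let 𝒮 := (Finset.univ : Finset (Fin N ⊕ (Fin (n + 1) ⊕ Fin (n + 1)))).powersetCard (n + 1)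
  refine ⟨⋃ S ∈ 𝒮, A S, ?_, ?_⟩
  · intro x hx
    obtain ⟨k, hkK, hk⟩ := Set.not_subset.1 hx
    have hn0 : (2 * (n : ℝ)) ≠ 0 := by positivity
    rw [Set.mem_smul_set_iff_inv_smul_mem₀ hn0] at hk
    obtain ⟨S, hcard, hS, hz⟩ := exists_gramSolution_separating hk
    refine Set.mem_iUnion₂.2 ⟨S, Finset.mem_powersetCard.2 ⟨Finset.subset_univ _, hcard⟩, ?_,
      fun i _ => hS i⟩
    set φ := gramSolution (normals x) (bounds n N) S with hφ
    let f : EuclideanSpace ℝ (Fin n) →L[ℝ] ℝ :=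
      LinearMap.toContinuousLinearMap
        (dotProductEquiv ℝ (Fin n) (Fin.tail φ) ∘ₗ (WithLp.linearEquiv 2 ℝ (Fin n → ℝ)).toLinearMap)
    have hf : ∀ y, homogenize y ⬝ᵥ φ = φ 0 + f y := fun y => by
      rw [dotProduct, Fin.sum_univ_succ]
      simp [homogenize, f, dotProduct, Fin.tail, mul_comm]
    refine (one_twelfth_le_cond_halfSpace hn hK hKc hv h0 f hkK).trans
      (measureReal_mono fun y hy => ?_)
    rw [hf, map_smul, smul_eq_mul] at hz
    simp only [Set.mem_ofPred_eq, sol, ← hφ, hf] at hy ⊢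
    rw [div_eq_inv_mul] at hy
    linarith
  · have hA : ∀ S ∈ 𝒮, Measure.pi (fun _ : Fin N => volume[|K]) (A S) ≤
        ENNReal.ofReal ((11 / 12) ^ (N - (n + 1))) := by
      intro S hS
      have hcard := (Finset.mem_powersetCard.1 hS).2
      refine (pi_measure_le_of_dependsOn (volume[|K]) (T S) (g := sol S) ?_ ?_ (1 / 12)).trans ?_
      · have : Continuous (Function.uncurry (sol S)) :=
          (continuous_homogenize.comp continuous_snd).dotProduct
            ((continuous_gramSolution S).comp continuous_fst)
        exact this.measurable
      · intro x x' h
        ext y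
        simp only [sol]
        rw [gramSolution_congr fun i hi => h i (Finset.mem_toLeft.2 hi)]
      · rw [Fintype.card_fin, ← ENNReal.ofReal_pow (by norm_num)]
        refine ENNReal.ofReal_le_ofReal ?_
        rw [show (1 : ℝ) - 1 / 12 = 11 / 12 by norm_num]
        refine pow_le_pow_of_le_one (by norm_num) (by norm_num) ?_
        have : (T S).card ≤ S.card := Finset.card_toLeft_le
        omega
    refine (measure_biUnion_finset_le _ _).trans_lt ((Finset.sum_le_sum hA).trans_lt ?_)
    rw [Finset.sum_const, Finset.card_powersetCard, Finset.card_univ, nsmul_eq_mul,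
      ← ENNReal.ofReal_natCast, ← ENNReal.ofReal_mul (by positivity)]
    refine (ENNReal.ofReal_lt_ofReal_iff (Real.exp_pos _)).2 ?_
    have : Fintype.card (Fin N ⊕ (Fin (n + 1) ⊕ Fin (n + 1))) = N + 2 * (n + 1) := by
      simp; ring
    rw [this]
    exact choose_mul_pow_lt_exp_neg hn hN

theorem theorem1p1 :
    ∃ α : ℝ, 1 < α ∧ ∃ c₁ : ℝ, 0 < c₁ ∧
      ∀ (n : ℕ), 1 ≤ n →
      ∀ (K : ConvexBody (EuclideanSpace ℝ (Fin n))),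
        (interior (K : Set (EuclideanSpace ℝ (Fin n)))).Nonempty →
        (⨍ x in (K : Set (EuclideanSpace ℝ (Fin n))), x) = 0 →
      ∀ (Ω : Type*) [MeasurableSpace Ω] (P : Measure Ω) [IsProbabilityMeasure P]
        (X : Fin ⌈α * (n : ℝ)⌉₊ → Ω → EuclideanSpace ℝ (Fin n)),
        iIndepFun X P →
        (∀ i, pdf.IsUniform (X i) (K : Set (EuclideanSpace ℝ (Fin n))) P volume) →
        1 - Real.exp (-(n : ℝ)) <
          P.real {ω | (K : Set (EuclideanSpace ℝ (Fin n))) ⊆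
            (c₁ * (n : ℝ)) • convexHull ℝ (Set.range fun i => X i ω)} := by
  refine ⟨240, by norm_num, 2, by norm_num, ?_⟩
  intro n hn K hint h0 Ω _ P _ X hindep hunif
  have hv : volume (K : Set (EuclideanSpace ℝ (Fin n))) ≠ 0 :=
    (Measure.measure_pos_of_nonempty_interior _ hint).ne'
  have hN : 240 * n ≤ ⌈(240 : ℝ) * n⌉₊ := by
    have := Nat.le_ceil ((240 : ℝ) * n)
    exact_mod_cast this
  obtain ⟨B, hB, hBlt⟩ := pi_measure_not_subset_lt hn hN K.isCompact K.convex hv h0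
  have hX : ∀ i, AEMeasurable (X i) P := fun i =>
    (hunif i).aemeasurable hv K.isCompact.measure_ne_top
  have hlaw : P.map (fun ω i => X i ω) = Measure.pi fun _ => volume[|(K : Set _)] := by
    rw [(iIndepFun_iff_map_fun_eq_pi_map hX).1 hindep]
    exact congrArg Measure.pi (funext hunif)
  set good : Set Ω := {ω | (K : Set (EuclideanSpace ℝ (Fin n))) ⊆
    (2 * (n : ℝ)) • convexHull ℝ (Set.range fun i => X i ω)} with hgood
  have hbad : P goodᶜ < ENNReal.ofReal (Real.exp (-n)) := by
    refine lt_of_le_of_lt ?_ (hlaw ▸ hBlt)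
    refine (measure_mono fun ω hω => ?_).trans
      (Measure.le_map_apply (aemeasurable_pi_lambda _ hX) B)
    exact hB hω
  have hbad' : P.real goodᶜ < Real.exp (-n) :=
    ENNReal.toReal_lt_of_lt_ofReal hbad
  -- `good` need not be measurable, so subadditivity replaces the formula for the complement
  have hone : 1 ≤ P.real good + P.real goodᶜ := by
    have := measureReal_union_le (μ := P) good goodᶜ
    rwa [Set.union_compl_self, probReal_univ] at this
  linarith
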